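/- Let $d\in\mathbb{N}=\{1,2,\dots\}$, let $\mathbb{S}^d=\{x\in\mathbb{R}^{d+1}:\|x\|_2=1\}$ and let $\pi_d$ be the normalized ($d$-dimensional) Hausdorff measure on $\mathbb{S}^d$. For $x\in\mathbb{S}^d$ and $t\in[-1,1]$ let $C(x,t)=\{y\in\mathbb{S}^d:\langle x,y\rangle>t\}$, and let $\mathcal{S}_d=\{C(x,t)\cap C(y,s): x,y\in\mathbb{S}^d,\ s,t\in[-1,1]\}$ be the set of spherical slices. For a finite set $\mathcal{P}\subseteq\mathbb{S}^d$ and $n\in\mathbb{N}$ put $$\mathrm{disp}(\mathcal{P};d)=\sup_{B\in\mathcal{S}_d,\ \mathcal{P}\cap B=\emptyset}\pi_d(B),\qquad \mathrm{disp}^*(n,d)=\inf_{\mathcal{P}\subseteq\mathbb{S}^d,\ \#\mathcal{P}=n}\mathrm{disp}(\mathcal{P};d),$$ and, for $\varepsilon>0$, let $$N(\varepsilon,d)=\min\{n\in\mathbb{N}:\mathrm{disp}^*(n,d)<\varepsilon\}$$ be the inverse of the minimal spherical dispersion. Then for every $\varepsilon\in\left(0,\frac{1}{9e}\right)$ and every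 $d\in\mathbb{N}$ this minimum exists, and $$\max\left\{\frac1\varepsilon+d-2,\ \frac1{2\varepsilon}+2d-2\right\}\le N(\varepsilon,d)\le 96\,\frac d\varepsilon\,\log\left(\frac{96}{\varepsilon}\right),$$ where $\log$ is the natural logarithm. Consequently: (i) for fixed $\varepsilon$, $N(\varepsilon,d)$ grows linearly in $d$: for every $\varepsilon\in\left(0,\frac1{9e}\right)$ there are constants $c,C>0$ (depending on $\varepsilon$) with $c\,d\le N(\varepsilon,d)\le C\,d$ for all $d\in\mathbb{N}$; (ii) for fixed $d$, $N(\varepsilon,d)$ grows linearly in $\varepsilon^{-1}$ up to a logarithmic factor in the upper bound: for every $d\in\mathbb{N}$ there are constants $c,C>0$ (depending on $d$) with $c\,\varepsilon^{-1}\le N(\varepsilon,d)\le C\,\varepsilon^{-1}\log(\varepsilon^{-1})$ for all $\varepsilon\in\left(0,\frac1{9e}\right)$. -/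

import Mathlib

open scoped ENNReal

namespace SphericalDispersion

/-- The Euclidean unit sphere of `ℝ^(d+1)`. -/
abbrev Sph (d : ℕ) : Type :=
  Metric.sphere (0 : EuclideanSpace ℝ (Fin (d + 1))) 1

/-- The normalized `d`-dimensional Hausdorff measure on the sphere (the uniform distribution). -/
noncomputable def unif (d : ℕ) : MeasureTheory.Measure (Sph d) :=
  (MeasureTheory.Measure.hausdorffMeasure (d : ℝ) (Set.univ : Set (Sph d)))⁻¹ •
    MeasureTheory.Measure.hausdorffMeasure (d : ℝ)

/-- The open spherical cap with center `x` and height parameter `t`. -/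
def cap {d : ℕ} (x : Sph d) (t : ℝ) : Set (Sph d) :=
  {y | t < inner ℝ (x : EuclideanSpace ℝ (Fin (d + 1))) (y : EuclideanSpace ℝ (Fin (d + 1)))}

/-- The spherical slices: intersections of two spherical caps. -/
def slices (d : ℕ) : Set (Set (Sph d)) :=
  {B | ∃ x y : Sph d, ∃ s ∈ Set.Icc (-1 : ℝ) 1, ∃ t ∈ Set.Icc (-1 : ℝ) 1,
    B = cap x t ∩ cap y s}

/-- The spherical dispersion of a finite point set: the supremum of the measures of the
slices that contain no point of it. -/
noncomputable def disp {d : ℕ} (P : Finset (Sph d)) : ℝ≥0∞ :=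
  ⨆ B ∈ {B ∈ slices d | (P : Set (Sph d)) ∩ B = ∅}, unif d B

/-- The minimal spherical dispersion of point sets with exactly `n` elements. -/
noncomputable def minDisp (n d : ℕ) : ℝ≥0∞ :=
  ⨅ P ∈ {P : Finset (Sph d) | P.card = n}, disp P

/-- The positive integers `n` for which the minimal dispersion is smaller than `ε`. -/
def admissible (ε : ℝ) (d : ℕ) : Set ℕ :=
  {n | 1 ≤ n ∧ minDisp n d < ENNReal.ofReal ε}

/-- The inverse `N(ε, d)` of the minimal spherical dispersion: the least admissible `n`. -/
noncomputable def invMinDisp (ε : ℝ) (d : ℕ) : ℕ :=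
  sInf (admissible ε d)

end SphericalDispersion

/-!
**Lower bound.** A lune, the intersection of two open hemispheres, is a slice. Through a point `p`
of a lune passes a great subsphere of the pencil spanned by its two bounding subspheres, and it
splits the lune into two lunes avoiding `p`. By induction, a lune containing `m` points of `P` has
measure at most `(m + 1) * disp P`. Some great subsphere contains `d` points of `P`; its two sides
give `1 ≤ (n - d + 2) * disp P`. A second one contains `d` of the remaining points, and the four
lunes cut out by both give `1 ≤ (n - 2 * d + 4) * disp P`. Points on these subspheres cost nothing
because great subspheres are null sets.

**Upper bound.** By Radon's theorem the half-spaces of `ℝ^(d+1)` have VC dimension at most `d + 2`,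
so by the Sauer–Shelah lemma slices have few traces, at most `G` say, on `2 * n` points. Suppose
that every sample of `n` points misses a slice of measure at least `p`. A second, independent sample
then hits that slice at least `k` times with high probability. But after swapping the entries of the
two samples by independent fair coins, each of the `G` traces is avoided by the first sample and hit
`k` times by the second one with probability at most `2 ^ (-k)`, so the event has probability at
most `G / 2 ^ k`. For `n` of order `(d / ε) * log (1 / ε)` this is a contradiction. Measurability is
ensured by working with the countably many slices with rational data, which approximate all slices
from inside.
-/

namespace SphericalDispersion

open MeasureTheory Measure Metric Module Set
open scoped InnerProductSpace Finset

section SphereHausdorffMeasure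

lemma hausdorffMeasure_image_lt_top_of_contDiff {F E : Type*}
    [NormedAddCommGroup F] [NormedSpace ℝ F] [FiniteDimensional ℝ F]
    [NormedAddCommGroup E] [NormedSpace ℝ E] [MeasurableSpace E] [BorelSpace E]
    {f : F → E} (hf : ContDiff ℝ 1 f) {K : Set F} (hK : IsCompact K) :
    μH[finrank ℝ F] (f '' K) < ∞ := by
  borelize F
  obtain ⟨C, hC⟩ :=
    (hf.locallyLipschitz.locallyLipschitzOn (s := K)).exists_lipschitzOnWith_of_compact hK
  calc μH[finrank ℝ F] (f '' K) ≤ C ^ (finrank ℝ F : ℝ) * μH[finrank ℝ F] K :=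
        hC.hausdorffMeasure_image_le (Nat.cast_nonneg _)
    _ < ∞ := ENNReal.mul_lt_top (by finiteness) hK.measure_lt_top

variable {E : Type*} [NormedAddCommGroup E] [InnerProductSpace ℝ E]

lemma norm_stereoToFun_le_two {v x : E} (hx : ‖x‖ ≤ 1) (hvx : ⟪v, x⟫_ℝ ≤ 0) :
    ‖stereoToFun v x‖ ≤ 2 := by
  have hcoeff : ‖2 / (1 - ⟪v, x⟫_ℝ)‖ ≤ 2 := by
    rw [Real.norm_of_nonneg (div_nonneg zero_le_two (by linarith))]
    exact div_le_self zero_le_two (by linarith)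
  calc ‖stereoToFun v x‖
      = ‖2 / (1 - ⟪v, x⟫_ℝ)‖ * ‖(ℝ ∙ v)ᗮ.orthogonalProjectionOnto x‖ := norm_smul _ _
    _ ≤ 2 * 1 := by
        gcongr
        exact ((ℝ ∙ v)ᗮ.norm_orthogonalProjectionOnto_apply_le x).trans hx
    _ = 2 := mul_one 2

lemma sphere_inter_inner_le_zero_subset {v : E} (hv : ‖v‖ = 1) :
    sphere (0 : E) 1 ∩ {x | ⟪v, x⟫_ℝ ≤ 0} ⊆
      (fun w : (ℝ ∙ v)ᗮ => (stereoInvFun hv w : E)) '' closedBall 0 2 := by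
  rintro x ⟨hx, hvx⟩
  have hxv : x ≠ v := by
    rintro rfl
    norm_num [hv] at hvx
  refine ⟨stereoToFun v x, ?_, congrArg Subtype.val (stereo_left_inv hv (x := ⟨x, hx⟩) hxv)⟩
  simpa using norm_stereoToFun_le_two (mem_sphere_zero_iff_norm.1 hx).le hvx

lemma ball_subset_orthogonalProjectionOnto_image_sphere {v : E} (hv : ‖v‖ = 1) :
    ball (0 : (ℝ ∙ v)ᗮ) 1 ⊆ (ℝ ∙ v)ᗮ.orthogonalProjectionOnto '' sphere (0 : E) 1 := by
  intro y hy
  have hvy : ⟪(y : E), v⟫_ℝ = 0 := Submodule.mem_orthogonal_singleton_iff_inner_left.1 y.2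
  have hy1 : 0 ≤ 1 - ‖y‖ ^ 2 := by
    have : ‖y‖ < 1 := by simpa using hy
    nlinarith [norm_nonneg y]
  refine ⟨y + √(1 - ‖y‖ ^ 2) • v, ?_, ?_⟩
  · rw [mem_sphere_zero_iff_norm, ← sq_eq_sq₀ (norm_nonneg _) zero_le_one, norm_add_sq_real,
      inner_smul_right, hvy, norm_smul, hv, mul_one, Real.norm_eq_abs, sq_abs, Real.sq_sqrt hy1]
    simp
  · rw [map_add, map_smul, Submodule.orthogonalProjectionOnto_mem_subspace_eq_self,
      Submodule.orthogonalProjectionOnto_orthogonal_apply_eq_zero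
        (Submodule.mem_span_singleton_self v), smul_zero, add_zero]

variable [MeasurableSpace E] [BorelSpace E] (n : ℕ) [Fact (finrank ℝ E = n + 1)]

variable (E) in
lemma hausdorffMeasure_sphere_lt_top : μH[n] (sphere (0 : E) 1) < ∞ := by
  have : FiniteDimensional ℝ E := .of_fact_finrank_eq_succ n
  have hhalf : ∀ v : E, ‖v‖ = 1 → μH[n] (sphere (0 : E) 1 ∩ {x | ⟪v, x⟫_ℝ ≤ 0}) < ∞ := by
    intro v hv
    have hsmooth : ContDiff ℝ 1 fun w : (ℝ ∙ v)ᗮ => (stereoInvFun hv w : E) :=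
      contDiff_stereoInvFunAux.comp (ℝ ∙ v)ᗮ.subtypeL.contDiff
    have himage := hausdorffMeasure_image_lt_top_of_contDiff hsmooth (isCompact_closedBall 0 2)
    rw [Submodule.finrank_orthogonal_span_singleton (n := n) (by simp [← norm_pos_iff, hv])]
      at himage
    exact (measure_mono (sphere_inter_inner_le_zero_subset hv)).trans_lt himage
  have : Nontrivial E := nontrivial_of_finrank_eq_succ (Fact.out : finrank ℝ E = n + 1)
  obtain ⟨v, hv⟩ := exists_norm_eq E zero_le_one
  have hcover : sphere (0 : E) 1 ⊆ (sphere (0 : E) 1 ∩ {x | ⟪v, x⟫_ℝ ≤ 0}) ∪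
      (sphere (0 : E) 1 ∩ {x | ⟪-v, x⟫_ℝ ≤ 0}) := by
    intro x hx
    simpa [mem_sphere_zero_iff_norm.1 hx] using le_total ⟪v, x⟫_ℝ 0
  exact (measure_mono hcover).trans_lt
    (measure_union_lt_top (hhalf v hv) (hhalf (-v) (by rwa [norm_neg])))

variable (E) in
lemma hausdorffMeasure_sphere_pos : 0 < μH[n] (sphere (0 : E) 1) := by
  have : FiniteDimensional ℝ E := .of_fact_finrank_eq_succ n
  have : Nontrivial E := nontrivial_of_finrank_eq_succ (Fact.out : finrank ℝ E = n + 1)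
  obtain ⟨v, hv⟩ := exists_norm_eq E zero_le_one
  calc (0 : ℝ≥0∞) < μH[n] (ball (0 : (ℝ ∙ v)ᗮ) 1) := by
        rw [← Submodule.finrank_orthogonal_span_singleton (𝕜 := ℝ) (n := n) (v := v)
          (by simp [← norm_pos_iff, hv])]
        exact isOpen_ball.measure_pos _ (nonempty_ball.2 one_pos)
    _ ≤ μH[n] ((ℝ ∙ v)ᗮ.orthogonalProjectionOnto '' sphere (0 : E) 1) :=
        measure_mono (ball_subset_orthogonalProjectionOnto_image_sphere hv)
    _ ≤ μH[n] (sphere (0 : E) 1) :=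
        hausdorffMeasure_orthogonalProjectionOnto_le _ _ _ (Nat.cast_nonneg n)

lemma hausdorffMeasure_sphere_inter_orthogonal {u : E} (hu : u ≠ 0) :
    μH[n] (sphere (0 : E) 1 ∩ (ℝ ∙ u)ᗮ) = 0 := by
  have hfin : finrank ℝ (ℝ ∙ u)ᗮ = n := Submodule.finrank_orthogonal_span_singleton hu
  have : FiniteDimensional ℝ E := .of_fact_finrank_eq_succ n
  have himage : sphere (0 : E) 1 ∩ (ℝ ∙ u)ᗮ = Subtype.val '' sphere (0 : (ℝ ∙ u)ᗮ) 1 := by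
    ext x
    simp [and_comm]
  cases n with
  | zero =>
    have : Subsingleton (ℝ ∙ u)ᗮ := finrank_zero_iff.1 hfin
    rw [himage, sphere_eq_empty_of_subsingleton one_ne_zero, image_empty, measure_empty]
  | succ m =>
    have : Fact (finrank ℝ (ℝ ∙ u)ᗮ = m + 1) := ⟨hfin⟩
    have hfinite : μH[m] (sphere (0 : E) 1 ∩ (ℝ ∙ u)ᗮ) < ∞ := by
      rw [himage, isometry_subtype_coe.hausdorffMeasure_image (Or.inl (Nat.cast_nonneg m))]
      exact hausdorffMeasure_sphere_lt_top (ℝ ∙ u)ᗮ m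
    exact (hausdorffMeasure_zero_or_top (by exact_mod_cast m.lt_succ_self) _).resolve_right
      hfinite.ne

end SphereHausdorffMeasure

section UniformMeasure

variable {d : ℕ}

lemma hausdorffMeasure_coe_image (s : Set (Sph d)) :
    μH[d] (Subtype.val '' s : Set (EuclideanSpace ℝ (Fin (d + 1)))) = μH[d] s :=
  isometry_subtype_coe.hausdorffMeasure_image (Or.inl (Nat.cast_nonneg d)) s

instance isProbabilityMeasure_unif (d : ℕ) : IsProbabilityMeasure (unif d) where
  measure_univ := by
    have : Fact (finrank ℝ (EuclideanSpace ℝ (Fin (d + 1))) = d + 1) := ⟨by simp⟩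
    have htotal : μH[d] (univ : Set (Sph d)) =
        μH[d] (sphere (0 : EuclideanSpace ℝ (Fin (d + 1))) 1) := by
      rw [← hausdorffMeasure_coe_image, image_univ, Subtype.range_coe]
    rw [unif, Measure.smul_apply, smul_eq_mul, htotal]
    exact ENNReal.inv_mul_cancel (hausdorffMeasure_sphere_pos _ d).ne'
      (hausdorffMeasure_sphere_lt_top _ d).ne

end UniformMeasure

section Lunes

variable {d : ℕ} {u v w : EuclideanSpace ℝ (Fin (d + 1))} {P : Finset (Sph d)}

/-- The great subsphere orthogonal to `w`; it is the whole sphere for `w = 0`. -/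
def greatSubsphere (w : EuclideanSpace ℝ (Fin (d + 1))) : Set (Sph d) :=
  {z | ⟪w, (z : EuclideanSpace ℝ (Fin (d + 1)))⟫_ℝ = 0}

/-- The open hemisphere in the direction of `w`, which need not be a unit vector; it is empty for
`w = 0`. -/
def hemisphere (w : EuclideanSpace ℝ (Fin (d + 1))) : Set (Sph d) :=
  {z | 0 < ⟪w, (z : EuclideanSpace ℝ (Fin (d + 1)))⟫_ℝ}

/-- The lune cut out by two open hemispheres, the spherical slices through which the lower bound
is proved. -/
def lune (u v : EuclideanSpace ℝ (Fin (d + 1))) : Set (Sph d) :=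
  hemisphere u ∩ hemisphere v

lemma unif_greatSubsphere (hw : w ≠ 0) : unif d (greatSubsphere w) = 0 := by
  have : Fact (finrank ℝ (EuclideanSpace ℝ (Fin (d + 1))) = d + 1) := ⟨by simp⟩
  have hsub : Subtype.val '' greatSubsphere w ⊆
      sphere (0 : EuclideanSpace ℝ (Fin (d + 1))) 1 ∩ (ℝ ∙ w)ᗮ := by
    rintro _ ⟨z, hz, rfl⟩
    exact ⟨z.2, Submodule.mem_orthogonal_singleton_iff_inner_right.2 hz⟩
  rw [unif, Measure.smul_apply, ← hausdorffMeasure_coe_image (greatSubsphere w),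
    measure_mono_null hsub (hausdorffMeasure_sphere_inter_orthogonal d hw), smul_zero]

lemma compl_greatSubsphere (w : EuclideanSpace ℝ (Fin (d + 1))) :
    (greatSubsphere w)ᶜ = hemisphere w ∪ hemisphere (-w) := by
  ext z
  simp [greatSubsphere, hemisphere, eq_comm]

lemma disjoint_hemisphere_neg (w : EuclideanSpace ℝ (Fin (d + 1))) :
    Disjoint (hemisphere w) (hemisphere (-w)) := by
  refine Set.disjoint_left.2 fun z hz hz' => ?_
  simp only [hemisphere, mem_ofPred_eq, inner_neg_left, Left.neg_pos_iff] at hz hz'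
  exact hz.not_gt hz'

lemma unif_le_add_inter_hemisphere (B : Set (Sph d)) (hw : w ≠ 0) :
    unif d B ≤ unif d (B ∩ hemisphere w) + unif d (B ∩ hemisphere (-w)) := by
  calc unif d B = unif d (B \ greatSubsphere w) :=
        (measure_sdiff_null (unif_greatSubsphere hw)).symm
    _ = unif d (B ∩ hemisphere w ∪ B ∩ hemisphere (-w)) := by
        rw [sdiff_eq, compl_greatSubsphere, inter_union_distrib_left]
    _ ≤ _ := measure_union_le _ _

lemma ncard_inter_hemisphere_add {A : Set (Sph d)} (hA : A.Finite)
    (w : EuclideanSpace ℝ (Fin (d + 1))) :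
    (A ∩ hemisphere w).ncard + (A ∩ hemisphere (-w)).ncard = (A \ greatSubsphere w).ncard := by
  rw [sdiff_eq, compl_greatSubsphere, inter_union_distrib_left, ncard_union_eq
    ((disjoint_hemisphere_neg w).mono inter_subset_right inter_subset_right)
    (hA.inter_of_left _) (hA.inter_of_left _)]

lemma exists_hemisphere_eq_cap (hw : w ≠ 0) : ∃ x : Sph d, hemisphere w = cap x 0 := by
  refine ⟨⟨‖w‖⁻¹ • w, by simp [norm_smul, hw]⟩, ?_⟩
  ext z
  simp [hemisphere, cap, inner_smul_left, hw]

lemma unif_lune_le_disp (hP : (P : Set (Sph d)) ∩ lune u v = ∅) : unif d (lune u v) ≤ disp P := by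
  rcases eq_or_ne u 0 with rfl | hu
  · simp [lune, hemisphere]
  rcases eq_or_ne v 0 with rfl | hv
  · simp [lune, hemisphere]
  obtain ⟨x, hx⟩ := exists_hemisphere_eq_cap hu
  obtain ⟨y, hy⟩ := exists_hemisphere_eq_cap hv
  have hslice : lune u v ∈ slices d := ⟨x, y, 0, by simp, 0, by simp, by rw [lune, hx, hy]⟩
  exact le_iSup₂_of_le (lune u v) ⟨hslice, hP⟩ le_rfl

lemma exists_ne_zero_forall_inner_eq_zero {E ι : Type*} [NormedAddCommGroup E]
    [InnerProductSpace ℝ E] [FiniteDimensional ℝ E] [Fintype ι] (p : ι → E)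
    (hcard : Fintype.card ι < finrank ℝ E) : ∃ w : E, w ≠ 0 ∧ ∀ i, ⟪w, p i⟫_ℝ = 0 := by
  have hspan : (Submodule.span ℝ (range p))ᗮ ≠ ⊥ := by
    rw [Ne, Submodule.orthogonal_eq_bot_iff]
    intro htop
    have := finrank_range_le_card (R := ℝ) p
    rw [Set.finrank, htop, finrank_top] at this
    omega
  obtain ⟨w, hw, hw0⟩ := Submodule.exists_mem_ne_zero_of_ne_bot hspan
  exact ⟨w, hw0, fun i => (Submodule.mem_orthogonal' _ w).1 hw _
    (Submodule.subset_span (mem_range_self i))⟩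

lemma exists_orthogonal_mem_pencil {E : Type*} [NormedAddCommGroup E] [InnerProductSpace ℝ E]
    [FiniteDimensional ℝ E] (hE : 1 < finrank ℝ E) (u v p : E) :
    ∃ w : E, w ≠ 0 ∧ ⟪w, p⟫_ℝ = 0 ∧ ∃ c : ℝ, 0 ≤ c ∧ c • w = ⟪v, p⟫_ℝ • u - ⟪u, p⟫_ℝ • v := by
  by_cases hx : ⟪v, p⟫_ℝ • u - ⟪u, p⟫_ℝ • v = 0
  · obtain ⟨w, hw, hwp⟩ := exists_ne_zero_forall_inner_eq_zero (fun _ : Unit => p) (by simpa)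
    exact ⟨w, hw, hwp (), 0, le_rfl, by rw [hx, zero_smul]⟩
  · refine ⟨_, hx, ?_, 1, zero_le_one, one_smul _ _⟩
    rw [inner_sub_left, real_inner_smul_left, real_inner_smul_left]
    ring

lemma exists_hemisphere_split_lune (hd : 1 ≤ d) {p : Sph d} (hp : p ∈ lune u v) :
    ∃ w : EuclideanSpace ℝ (Fin (d + 1)), w ≠ 0 ∧ p ∈ greatSubsphere w ∧
      lune u v ∩ hemisphere w = lune w v ∧ lune u v ∩ hemisphere (-w) = lune u (-w) := by
  obtain ⟨hup : 0 < ⟪u, p.1⟫_ℝ, hvp : 0 < ⟪v, p.1⟫_ℝ⟩ := hp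
  obtain ⟨w, hw, hwp, c, hc, hcw⟩ :=
    exists_orthogonal_mem_pencil (by simpa using Nat.pos_of_ne_zero (by omega)) u v p.1
  have hpencil : ∀ z : Sph d,
      c * ⟪w, z.1⟫_ℝ = ⟪v, p.1⟫_ℝ * ⟪u, z.1⟫_ℝ - ⟪u, p.1⟫_ℝ * ⟪v, z.1⟫_ℝ := by
    intro z
    rw [← real_inner_smul_left, hcw, inner_sub_left, real_inner_smul_left, real_inner_smul_left]
  have hu_pos : ∀ z ∈ lune w v, z ∈ hemisphere u := by
    rintro z ⟨hwz : 0 < ⟪w, z.1⟫_ℝ, hvz : 0 < ⟪v, z.1⟫_ℝ⟩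
    refine pos_of_mul_pos_right (b := ⟪u, z.1⟫_ℝ) ?_ hvp.le
    linarith [hpencil z, mul_nonneg hc hwz.le, mul_pos hup hvz]
  have hv_pos : ∀ z ∈ lune u (-w), z ∈ hemisphere v := by
    rintro z ⟨huz : 0 < ⟪u, z.1⟫_ℝ, hwz : 0 < ⟪-w, z.1⟫_ℝ⟩
    rw [inner_neg_left] at hwz
    refine pos_of_mul_pos_right (b := ⟪v, z.1⟫_ℝ) ?_ hup.le
    linarith [hpencil z, mul_nonneg hc hwz.le, mul_pos hvp huz]
  refine ⟨w, hw, hwp, Subset.antisymm ?_ ?_, Subset.antisymm ?_ ?_⟩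
  · exact fun z hz => ⟨hz.2, hz.1.2⟩
  · exact fun z hz => ⟨⟨hu_pos z hz, hz.2⟩, hz.1⟩
  · exact fun z hz => ⟨hz.1.1, hz.2⟩
  · exact fun z hz => ⟨⟨hz.1, hv_pos z hz⟩, hz.2⟩

lemma unif_lune_le_ncard_mul_disp (hd : 1 ≤ d) (P : Finset (Sph d))
    (u v : EuclideanSpace ℝ (Fin (d + 1))) :
    unif d (lune u v) ≤ ((P ∩ lune u v : Set (Sph d)).ncard + 1) * disp P := by
  induction hk : (P ∩ lune u v : Set (Sph d)).ncard using Nat.strong_induction_on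
    generalizing u v with
  | _ k ih =>
  have hfin : (P ∩ lune u v : Set (Sph d)).Finite := P.finite_toSet.inter_of_left _
  rcases (P ∩ lune u v : Set (Sph d)).eq_empty_or_nonempty with hempty | ⟨p, hpP, hp⟩
  · exact (unif_lune_le_disp hempty).trans (le_mul_of_one_le_left' le_add_self)
  obtain ⟨w, hw, hpw, hpos, hneg⟩ := exists_hemisphere_split_lune hd hp
  have hlt : ((P ∩ lune u v : Set (Sph d)) \ greatSubsphere w).ncard < k :=
    hk ▸ ncard_lt_ncard ⟨sdiff_subset, fun h => (h ⟨hpP, hp⟩).2 hpw⟩ hfin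
  have hsplit := ncard_inter_hemisphere_add hfin w
  rw [inter_assoc, inter_assoc, hpos, hneg] at hsplit
  calc unif d (lune u v) ≤ unif d (lune w v) + unif d (lune u (-w)) := by
        rw [← hpos, ← hneg]; exact unif_le_add_inter_hemisphere _ hw
    _ ≤ ((P ∩ lune w v : Set (Sph d)).ncard + 1) * disp P +
          ((P ∩ lune u (-w) : Set (Sph d)).ncard + 1) * disp P :=
        add_le_add (ih _ (by omega) w v rfl) (ih _ (by omega) u (-w) rfl)
    _ = ((P ∩ lune w v : Set (Sph d)).ncard + (P ∩ lune u (-w) : Set (Sph d)).ncard + 1 + 1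
          : ℕ) * disp P := by push_cast; ring
    _ ≤ (k + 1 : ℕ) * disp P := by gcongr; omega
    _ = (k + 1) * disp P := by push_cast; rfl

lemma unif_hemisphere_le (hd : 1 ≤ d) (P : Finset (Sph d))
    (u : EuclideanSpace ℝ (Fin (d + 1))) (hw : w ≠ 0) :
    unif d (hemisphere u) ≤
      (((P ∩ hemisphere u : Set (Sph d)) \ greatSubsphere w).ncard + 2) * disp P := by
  rw [← ncard_inter_hemisphere_add (P.finite_toSet.inter_of_left _), inter_assoc, inter_assoc]
  calc unif d (hemisphere u) ≤ unif d (lune u w) + unif d (lune u (-w)) :=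
        unif_le_add_inter_hemisphere _ hw
    _ ≤ ((P ∩ lune u w : Set (Sph d)).ncard + 1) * disp P +
          ((P ∩ lune u (-w) : Set (Sph d)).ncard + 1) * disp P :=
        add_le_add (unif_lune_le_ncard_mul_disp hd P u w)
          (unif_lune_le_ncard_mul_disp hd P u (-w))
    _ = _ := by simp only [lune]; push_cast; ring

lemma one_le_ncard_sdiff_greatSubsphere_mul_disp (hd : 1 ≤ d) (P : Finset (Sph d)) (hw : w ≠ 0) :
    1 ≤ (((P : Set (Sph d)) \ greatSubsphere w).ncard + 2) * disp P := by
  have hhemi : ∀ u : EuclideanSpace ℝ (Fin (d + 1)),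
      unif d (hemisphere u) ≤ ((P ∩ hemisphere u : Set (Sph d)).ncard + 1) * disp P := fun u => by
    simpa [lune] using unif_lune_le_ncard_mul_disp hd P u u
  rw [← ncard_inter_hemisphere_add P.finite_toSet]
  calc 1 = unif d univ := measure_univ.symm
    _ ≤ unif d (hemisphere w) + unif d (hemisphere (-w)) := by
        simpa using unif_le_add_inter_hemisphere univ hw
    _ ≤ _ := add_le_add (hhemi w) (hhemi (-w))
    _ = _ := by push_cast; ring

lemma one_le_ncard_sdiff_sdiff_greatSubsphere_mul_disp (hd : 1 ≤ d) (P : Finset (Sph d))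
    {w w' : EuclideanSpace ℝ (Fin (d + 1))} (hw : w ≠ 0) (hw' : w' ≠ 0) :
    1 ≤ ((((P : Set (Sph d)) \ greatSubsphere w) \ greatSubsphere w').ncard + 4) * disp P := by
  rw [Set.sdiff_sdiff_comm, ← ncard_inter_hemisphere_add P.finite_toSet.sdiff,
    sdiff_inter_right_comm, sdiff_inter_right_comm]
  calc 1 = unif d univ := measure_univ.symm
    _ ≤ unif d (hemisphere w) + unif d (hemisphere (-w)) := by
        simpa using unif_le_add_inter_hemisphere univ hw
    _ ≤ _ := add_le_add (unif_hemisphere_le hd P w hw') (unif_hemisphere_le hd P (-w) hw')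
    _ = _ := by push_cast; ring

lemma exists_ncard_sdiff_greatSubsphere_le {A : Set (Sph d)} (hA : A.Finite) :
    ∃ w : EuclideanSpace ℝ (Fin (d + 1)), w ≠ 0 ∧ (A \ greatSubsphere w).ncard ≤ A.ncard - d := by
  obtain ⟨S, hSA, hS⟩ := exists_subset_card_eq (min_le_left A.ncard d)
  have hSfin : S.Finite := hA.subset hSA
  have : Fintype S := hSfin.fintype
  obtain ⟨w, hw, hSw⟩ := exists_ne_zero_forall_inner_eq_zero
    (fun z : S => (z.1 : EuclideanSpace ℝ (Fin (d + 1)))) (by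
      rw [← Nat.card_eq_fintype_card, Nat.card_coe_set_eq, hS]
      simp)
  have hsub : A \ greatSubsphere w ⊆ A \ S := sdiff_subset_sdiff_right fun z hz => hSw ⟨z, hz⟩
  refine ⟨w, hw, (ncard_le_ncard hsub hA.sdiff).trans ?_⟩
  rw [ncard_sdiff hSA hSfin, hS]
  omega

lemma one_le_card_sub_mul_disp (hd : 1 ≤ d) (P : Finset (Sph d)) :
    1 ≤ ((#P - d + 2 : ℕ) : ℝ≥0∞) * disp P ∧
      1 ≤ ((#P - 2 * d + 4 : ℕ) : ℝ≥0∞) * disp P := by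
  obtain ⟨w, hw, hcard⟩ := exists_ncard_sdiff_greatSubsphere_le P.finite_toSet
  obtain ⟨w', hw', hcard'⟩ :=
    exists_ncard_sdiff_greatSubsphere_le (P.finite_toSet.sdiff (t := greatSubsphere w))
  rw [ncard_coe_finset] at hcard
  constructor
  · refine (one_le_ncard_sdiff_greatSubsphere_mul_disp hd P hw).trans ?_
    rw [Nat.cast_add, Nat.cast_ofNat]
    gcongr
  · refine (one_le_ncard_sdiff_sdiff_greatSubsphere_mul_disp hd P hw hw').trans ?_
    rw [Nat.cast_add, Nat.cast_ofNat]
    gcongr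
    omega

end Lunes

section LowerBound

lemma one_div_add_sub_le_of_one_le_mul {ε : ℝ} {δ : ℝ≥0∞} {n k m : ℕ} (hε : 0 < ε)
    (hδ : δ < ENNReal.ofReal ε) (h : 1 ≤ ((n - k + m : ℕ) : ℝ≥0∞) * δ) (hεm : ε * m ≤ 1) :
    1 / ε + k - m ≤ n := by
  have hlt : 1 < ((n - k + m : ℕ) : ℝ) * ε := by
    rw [← ENNReal.one_lt_ofReal, ENNReal.ofReal_mul (Nat.cast_nonneg _), ENNReal.ofReal_natCast]
    refine h.trans_lt (ENNReal.mul_lt_mul_right ?_ (ENNReal.natCast_ne_top _) hδ)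
    intro hzero
    simp [hzero] at h
  have hkn : k ≤ n := by
    by_contra! hnk
    rw [Nat.sub_eq_zero_of_le hnk.le, zero_add] at hlt
    linarith
  rw [← div_lt_iff₀ hε, Nat.cast_add, Nat.cast_sub hkn] at hlt
  linarith

lemma one_div_add_le_of_minDisp_lt {ε : ℝ} (hε : 0 < ε) {n d : ℕ} (hd : 1 ≤ d)
    (hn : minDisp n d < ENNReal.ofReal ε) :
    (ε ≤ 1 / 2 → 1 / ε + d - 2 ≤ n) ∧ (ε ≤ 1 / 4 → 1 / ε + 2 * d - 4 ≤ n) := by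
  obtain ⟨P, rfl, hdisp⟩ : ∃ P : Finset (Sph d), #P = n ∧ disp P < ENNReal.ofReal ε := by
    simpa only [minDisp, iInf_lt_iff, mem_ofPred_eq, exists_prop] using hn
  obtain ⟨htwo, hfour⟩ := one_le_card_sub_mul_disp hd P
  constructor <;> intro hle
  · exact_mod_cast one_div_add_sub_le_of_one_le_mul (m := 2) hε hdisp htwo
      (by push_cast; linarith)
  · exact_mod_cast one_div_add_sub_le_of_one_le_mul (m := 4) (k := 2 * d) hε hdisp
      hfour (by push_cast; linarith)

lemma max_le_of_mem_admissible {ε : ℝ} (hε : 0 < ε) (hε' : ε ≤ 1 / 4) {n d : ℕ} (hd : 1 ≤ d)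
    (hn : n ∈ admissible ε d) : max (1 / ε + d - 2) (1 / (2 * ε) + 2 * d - 2) ≤ n := by
  obtain ⟨htwo, hfour⟩ := one_div_add_le_of_minDisp_lt hε hd hn.2
  have hinv : 4 ≤ 1 / ε := by rw [le_div_iff₀ hε]; linarith
  have hhalf : 1 / (2 * ε) = 1 / ε / 2 := by field_simp
  refine max_le (htwo (by linarith)) ?_
  linarith [hfour hε']

end LowerBound
section EpsilonNet

variable {Ω ι : Type*} [Fintype ι]

open Classical in
/-- The trace of `B` on a family of points `w`: the indices of the points lying in `B`. Indices
rather than points are recorded, so that repeated points are harmless. -/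
noncomputable def trace (w : ι → Ω) (B : Set Ω) : Finset ι :=
  {i | w i ∈ B}

@[simp]
lemma mem_trace {w : ι → Ω} {B : Set Ω} {i : ι} : i ∈ trace w B ↔ w i ∈ B := by
  simp [trace]

/-- The traces of the members of `F` on `w`; the growth function of `F` bounds their number. -/
noncomputable def traces (F : Set (Set Ω)) (w : ι → Ω) : Finset (Finset ι) :=
  (Set.toFinite (trace w '' F)).toFinset

lemma mem_traces {F : Set (Set Ω)} {w : ι → Ω} {T : Finset ι} :
    T ∈ traces F w ↔ ∃ B ∈ F, trace w B = T := by
  simp [traces]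

lemma card_filter_forall_mem_eq_mul {α : Type*} [Fintype α] [DecidableEq ι] [DecidableEq α]
    (J : Finset ι) (σ₀ : ι → α) :
    #{σ : ι → α | ∀ i ∈ J, σ i = σ₀ i} * Fintype.card α ^ #J =
      Fintype.card α ^ Fintype.card ι := by
  have hpi : ({σ : ι → α | ∀ i ∈ J, σ i = σ₀ i} : Finset (ι → α)) =
      Fintype.piFinset fun i => if i ∈ J then {σ₀ i} else Finset.univ := by
    ext σ
    simp only [Finset.mem_filter_univ, Fintype.mem_piFinset]
    refine forall_congr' fun i => ?_
    split_ifs with hi <;> simp [hi]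
  have hcard : ∀ i, #(if i ∈ J then {σ₀ i} else (Finset.univ : Finset α)) =
      if i ∈ J then 1 else Fintype.card α := fun i => by
    split_ifs <;> simp
  rw [hpi, Fintype.card_piFinset, Finset.prod_congr rfl fun i _ => hcard i, Finset.prod_ite,
    Finset.prod_const_one, one_mul, Finset.prod_const, ← pow_add, Finset.filter_not,
    Finset.filter_mem_eq_inter, Finset.univ_inter, ← Finset.compl_eq_univ_sdiff,
    Finset.card_compl_add_card]

lemma card_filter_swaps_mul_le [DecidableEq ι] (T : Finset (ι × Bool)) (k : ℕ) :
    #{σ : ι → Bool | (∀ i, (i, σ i) ∉ T) ∧ k ≤ #{i | (i, !σ i) ∈ T}} * 2 ^ k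
      ≤ 2 ^ Fintype.card ι := by
  set S : Finset (ι → Bool) := {σ | (∀ i, (i, σ i) ∉ T) ∧ k ≤ #{i | (i, !σ i) ∈ T}}
  rcases S.eq_empty_or_nonempty with hempty | ⟨σ₀, hσ₀⟩
  · simp [hempty]
  set J : Finset ι := {i | (i, !σ₀ i) ∈ T}
  have hJ : k ≤ #J := (Finset.mem_filter_univ _ |>.1 hσ₀).2
  -- Differing from `σ₀` at an index of `J` would put a point of `T` into the first sample.
  have hsub : S ⊆ ({σ | ∀ i ∈ J, σ i = σ₀ i} : Finset (ι → Bool)) := by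
    intro σ hσ
    refine (Finset.mem_filter_univ _).2 fun i hi => ?_
    by_contra hne
    refine ((Finset.mem_filter_univ _).1 hσ).1 i ?_
    rw [Bool.eq_not_of_ne hne]
    exact (Finset.mem_filter_univ i).1 hi
  calc #S * 2 ^ k ≤ #{σ : ι → Bool | ∀ i ∈ J, σ i = σ₀ i} * 2 ^ #J := by gcongr; norm_num
    _ = 2 ^ Fintype.card ι := card_filter_forall_mem_eq_mul J σ₀

/-- Swap the two entries of a pair of samples at the indices where `σ` is true. -/
def swapAt (σ : ι → Bool) (z : ι → Ω × Ω) : ι → Ω × Ω :=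
  fun i => if σ i then (z i).swap else z i

/-- The pairs of samples such that some member of `F` is missed by the first sample but hit at least
`k` times by the second one. -/
def badPairs (F : Set (Set Ω)) (k : ℕ) : Set (ι → Ω × Ω) :=
  {z | ∃ B ∈ F, (∀ i, (z i).1 ∉ B) ∧ k ≤ #(trace (fun i => (z i).2) B)}

open Classical in
lemma card_filter_swapAt_mem_badPairs_mul_le {F : Set (Set Ω)} {G : ℕ}
    (hG : ∀ w : ι × Bool → Ω, #(traces F w) ≤ G) (k : ℕ) (z : ι → Ω × Ω) :
    #{σ | swapAt σ z ∈ badPairs F k} * 2 ^ k ≤ G * 2 ^ Fintype.card ι := by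
  set w : ι × Bool → Ω := fun q => if q.2 then (z q.1).2 else (z q.1).1
  have hfst : ∀ σ i, (swapAt σ z i).1 = w (i, σ i) := fun σ i => by
    cases hi : σ i <;> simp [swapAt, w, hi]
  have hsnd : ∀ σ i, (swapAt σ z i).2 = w (i, !σ i) := fun σ i => by
    cases hi : σ i <;> simp [swapAt, w, hi]
  have hsub : ({σ | swapAt σ z ∈ badPairs F k} : Finset (ι → Bool)) ⊆
      (traces F w).biUnion fun T => {σ | (∀ i, (i, σ i) ∉ T) ∧ k ≤ #{i | (i, !σ i) ∈ T}} := by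
    intro σ hσ
    obtain ⟨B, hB, hmiss, hhit⟩ := (Finset.mem_filter_univ _).1 hσ
    refine Finset.mem_biUnion.2 ⟨trace w B, mem_traces.2 ⟨B, hB, rfl⟩, ?_⟩
    simpa only [trace, Finset.mem_filter_univ, hfst, hsnd] using And.intro hmiss hhit
  calc _ ≤ (∑ T ∈ traces F w,
          #{σ : ι → Bool | (∀ i, (i, σ i) ∉ T) ∧ k ≤ #{i | (i, !σ i) ∈ T}}) * 2 ^ k := by
        gcongr
        exact (Finset.card_le_card hsub).trans Finset.card_biUnion_le
    _ ≤ ∑ _T ∈ traces F w, 2 ^ Fintype.card ι := by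
        rw [Finset.sum_mul]
        exact Finset.sum_le_sum fun T _ => card_filter_swaps_mul_le T k
    _ ≤ G * 2 ^ Fintype.card ι := by
        rw [Finset.sum_const, smul_eq_mul]
        gcongr
        exact hG w

open Classical in
lemma card_mul_measureReal_le {X S : Type*} [MeasurableSpace X] {ν : Measure X}
    [IsProbabilityMeasure ν] [Fintype S] {g : S → X → X} (hg : ∀ s, MeasurePreserving (g s) ν ν)
    {A : Set X} (hA : MeasurableSet A) {c : ℝ} (hc : ∀ z, (#{s | g s z ∈ A} : ℝ) ≤ c) :
    Fintype.card S * ν.real A ≤ c := by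
  have hint : ∀ s, Integrable ((g s ⁻¹' A).indicator (1 : X → ℝ)) ν := fun s =>
    (integrable_const 1).indicator ((hg s).measurable hA)
  calc Fintype.card S * ν.real A = ∑ s, ∫ z, (g s ⁻¹' A).indicator 1 z ∂ν := by
        simp_rw [integral_indicator_one ((hg _).measurable hA),
          (hg _).measureReal_preimage hA.nullMeasurableSet]
        simp
    _ = ∫ z, (#{s | g s z ∈ A} : ℝ) ∂ν := by
        rw [← integral_finsetSum _ fun s _ => hint s]
        simp [indicator_apply]
    _ ≤ ∫ _z, c ∂ν := by
        refine integral_mono_of_nonneg (.of_forall fun z => ?_) (integrable_const c) (.of_forall hc)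
        positivity
    _ = c := by simp

lemma le_prod_of_forall_le_preimage {X Y : Type*} [MeasurableSpace X] [MeasurableSpace Y]
    {ν : Measure X} [IsProbabilityMeasure ν] {ρ : Measure Y} [SFinite ρ] {A : Set (X × Y)}
    (hA : MeasurableSet A) {c : ℝ≥0∞} (hc : ∀ x, c ≤ ρ (Prod.mk x ⁻¹' A)) : c ≤ (ν.prod ρ) A := by
  calc c = ∫⁻ _x, c ∂ν := by simp
    _ ≤ ∫⁻ x, ρ (Prod.mk x ⁻¹' A) ∂ν := lintegral_mono hc
    _ = (ν.prod ρ) A := (prod_apply hA).symm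

variable [MeasurableSpace Ω] {μ : Measure Ω} [IsProbabilityMeasure μ]

lemma measurable_card_trace {B : Set Ω} (hB : MeasurableSet B) :
    Measurable fun w : ι → Ω => #(trace w B) := by
  simp_rw [trace, Finset.card_filter]
  exact Finset.measurable_sum _ fun i _ =>
    Measurable.ite (hB.preimage (measurable_pi_apply i)) measurable_const measurable_const

lemma measurableSet_badPairs {F : Set (Set Ω)} (hF : F.Countable)
    (hm : ∀ B ∈ F, MeasurableSet B) (k : ℕ) :
    MeasurableSet (badPairs F k : Set (ι → Ω × Ω)) := by
  have hunion : (badPairs F k : Set (ι → Ω × Ω)) = ⋃ B ∈ F, (⋂ i, {z | (z i).1 ∈ Bᶜ}) ∩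
      {z | k ≤ #(trace (fun i => (z i).2) B)} := by
    ext z
    simp only [badPairs, mem_iUnion, mem_inter_iff, mem_iInter, exists_prop]
    rfl
  rw [hunion]
  refine MeasurableSet.biUnion hF fun B hB => MeasurableSet.inter ?_ ?_
  · exact MeasurableSet.iInter fun i => (hm B hB).compl.preimage (by fun_prop)
  · exact measurableSet_le measurable_const ((measurable_card_trace (hm B hB)).comp (by fun_prop))

lemma measurePreserving_swapAt (σ : ι → Bool) :
    MeasurePreserving (swapAt σ) (Measure.pi fun _ : ι => μ.prod μ)
      (Measure.pi fun _ : ι => μ.prod μ) := by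
  have hpi := measurePreserving_pi (fun _ : ι => μ.prod μ) (fun _ => μ.prod μ)
    (f := fun i p => if σ i then p.swap else p) fun i => by
      cases σ i
      · exact MeasurePreserving.id _
      · exact Measure.measurePreserving_swap
  exact hpi

lemma measureReal_badPairs_le {F : Set (Set Ω)} {G : ℕ} (hF : F.Countable)
    (hm : ∀ B ∈ F, MeasurableSet B) (hG : ∀ w : ι × Bool → Ω, #(traces F w) ≤ G) (k : ℕ) :
    (Measure.pi fun _ : ι => μ.prod μ).real (badPairs F k) ≤ G / 2 ^ k := by
  classical
  have hswap := card_mul_measureReal_le (measurePreserving_swapAt (μ := μ) (ι := ι))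
    (measurableSet_badPairs hF hm k) (c := G / 2 ^ k * 2 ^ Fintype.card ι) fun z => by
      rw [div_mul_eq_mul_div, le_div_iff₀ (by positivity)]
      exact_mod_cast card_filter_swapAt_mem_badPairs_mul_le hG k z
  rw [Fintype.card_fun, Fintype.card_bool, mul_comm] at hswap
  push_cast at hswap
  exact le_of_mul_le_mul_right hswap (by positivity)

lemma integral_pow_card_trace {B : Set Ω} (hB : MeasurableSet B) (r : ℝ) :
    ∫ w : ι → Ω, r ^ #(trace w B) ∂(Measure.pi fun _ => μ) =
      (1 - (1 - r) * μ.real B) ^ Fintype.card ι := by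
  classical
  have hprod : ∀ w : ι → Ω, r ^ #(trace w B) = ∏ i, (1 - B.indicator (fun _ => 1 - r) (w i)) := by
    intro w
    have : ∀ i, 1 - B.indicator (fun _ => 1 - r) (w i) = if w i ∈ B then r else 1 := fun i => by
      rw [indicator_apply]; split_ifs <;> ring
    simp [this, Finset.prod_ite, trace]
  have hint : ∫ x, (1 - B.indicator (fun _ => 1 - r) x) ∂μ = 1 - (1 - r) * μ.real B := by
    rw [integral_sub (integrable_const _) ((integrable_const _).indicator hB),
      integral_indicator_const _ hB, smul_eq_mul, mul_comm]
    simp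
  simp_rw [hprod]
  rw [integral_fintype_prod_eq_pow (fun x => 1 - B.indicator (fun _ => 1 - r) x), hint]

lemma measureReal_card_trace_lt_le {B : Set Ω} (hB : MeasurableSet B) (k : ℕ) :
    (Measure.pi fun _ : ι => μ).real {w | #(trace w B) < k}
      ≤ 2 ^ k * (1 - μ.real B / 2) ^ Fintype.card ι := by
  have hintegrable : Integrable (fun w : ι → Ω => (1 / 2 : ℝ) ^ #(trace w B))
      (Measure.pi fun _ => μ) := by
    refine Integrable.of_bound (C := 1) ?_ (.of_forall fun w => ?_)
    · exact ((measurable_from_nat (f := fun m => (1 / 2 : ℝ) ^ m)).comp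
        (measurable_card_trace hB)).aestronglyMeasurable
    · rw [Real.norm_of_nonneg (by positivity)]
      exact pow_le_one₀ (by norm_num) (by norm_num)
  -- A Chernoff bound: Markov's inequality for `2 ^ (-#(trace w B))`.
  have hmarkov := mul_meas_ge_le_integral_of_nonneg
    (.of_forall fun w => by positivity) hintegrable ((1 / 2) ^ k)
  rw [integral_pow_card_trace hB] at hmarkov
  have hsub : {w : ι → Ω | #(trace w B) < k} ⊆ {w | (1 / 2 : ℝ) ^ k ≤ (1 / 2) ^ #(trace w B)} :=
    fun w (hw : _ < k) => by
      rw [mem_ofPred_eq]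
      exact pow_le_pow_of_le_one (by norm_num) (by norm_num) hw.le
  calc (Measure.pi fun _ : ι => μ).real {w | #(trace w B) < k}
      ≤ (Measure.pi fun _ : ι => μ).real {w | (1 / 2 : ℝ) ^ k ≤ (1 / 2) ^ #(trace w B)} :=
        measureReal_mono hsub
    _ = 2 ^ k * ((1 / 2) ^ k * (Measure.pi fun _ : ι => μ).real
          {w | (1 / 2 : ℝ) ^ k ≤ (1 / 2) ^ #(trace w B)}) := by
        rw [← mul_assoc, ← mul_pow]; norm_num
    _ ≤ 2 ^ k * (1 - (1 - 1 / 2) * μ.real B) ^ Fintype.card ι := by gcongr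
    _ = 2 ^ k * (1 - μ.real B / 2) ^ Fintype.card ι := by ring_nf

lemma one_sub_le_measureReal_badPairs {F : Set (Set Ω)} (hF : F.Countable)
    (hm : ∀ B ∈ F, MeasurableSet B) {p : ℝ} (hp : ∀ B ∈ F, p ≤ μ.real B)
    (hmiss : ∀ X : ι → Ω, ∃ B ∈ F, ∀ i, X i ∉ B) (k : ℕ) :
    1 - 2 ^ k * (1 - p / 2) ^ Fintype.card ι ≤
      (Measure.pi fun _ : ι => μ.prod μ).real (badPairs F k) := by
  have hbad : MeasurableSet (badPairs F k : Set (ι → Ω × Ω)) := measurableSet_badPairs hF hm k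
  have hmp := (measurePreserving_arrowProdEquivProdArrow Ω Ω ι (fun _ => μ) (fun _ => μ)).symm
  rw [← hmp.measureReal_preimage hbad.nullMeasurableSet, measureReal_def,
    ← ENNReal.ofReal_le_iff_le_toReal (measure_ne_top _ _)]
  refine le_prod_of_forall_le_preimage (hmp.measurable hbad) fun X => ?_
  obtain ⟨B, hB, hX⟩ := hmiss X
  have hfew : MeasurableSet {Y : ι → Ω | #(trace Y B) < k} :=
    measurableSet_lt (measurable_card_trace (hm B hB)) measurable_const
  have htail : (1 - μ.real B / 2) ^ Fintype.card ι ≤ (1 - p / 2) ^ Fintype.card ι := by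
    have : μ.real B ≤ 1 := measureReal_le_one
    exact pow_le_pow_left₀ (by linarith) (by linarith [hp B hB]) _
  calc ENNReal.ofReal (1 - 2 ^ k * (1 - p / 2) ^ Fintype.card ι)
      ≤ ENNReal.ofReal ((Measure.pi fun _ : ι => μ).real {Y | #(trace Y B) < k}ᶜ) := by
        rw [probReal_compl_eq_one_sub hfew]
        gcongr
        exact (measureReal_card_trace_lt_le (hm B hB) k).trans (by gcongr)
    _ = (Measure.pi fun _ : ι => μ) {Y | #(trace Y B) < k}ᶜ := ofReal_measureReal
    _ ≤ _ := measure_mono fun Y hY =>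
        show (fun i => (X i, Y i)) ∈ badPairs F k from ⟨B, hB, hX, not_lt.1 hY⟩

theorem exists_epsilonNet_of_card_traces_le {F : Set (Set Ω)} {G : ℕ} (hF : F.Countable)
    (hm : ∀ B ∈ F, MeasurableSet B) (hG : ∀ w : ι × Bool → Ω, #(traces F w) ≤ G) {p : ℝ}
    (hp : ∀ B ∈ F, p ≤ μ.real B) {k : ℕ}
    (hk : (G : ℝ) / 2 ^ k + 2 ^ k * (1 - p / 2) ^ Fintype.card ι < 1) :
    ∃ X : ι → Ω, ∀ B ∈ F, ∃ i, X i ∈ B := by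
  by_contra! hmiss
  linarith [measureReal_badPairs_le (μ := μ) hF hm hG k,
    one_sub_le_measureReal_badPairs (μ := μ) hF hm hp hmiss k]

end EpsilonNet

section HalfSpaces

variable {E ι : Type*} [Fintype ι]

lemma card_traces_le_sq_of_eq_inter_preimage {Ω : Type*} {F : Set (Set Ω)} {H : Set (Set E)}
    {g : Ω → E} (hF : ∀ B ∈ F, ∃ H₁ ∈ H, ∃ H₂ ∈ H, B = g ⁻¹' H₁ ∩ g ⁻¹' H₂) (w : ι → Ω) :
    #(traces F w) ≤ #(traces H (g ∘ w)) ^ 2 := by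
  classical
  have hsub : traces F w ⊆
      Finset.image₂ (· ∩ ·) (traces H (g ∘ w)) (traces H (g ∘ w)) := by
    intro T hT
    obtain ⟨B, hB, rfl⟩ := mem_traces.1 hT
    obtain ⟨H₁, hH₁, H₂, hH₂, rfl⟩ := hF B hB
    exact Finset.mem_image₂.2 ⟨_, mem_traces.2 ⟨H₁, hH₁, rfl⟩, _, mem_traces.2 ⟨H₂, hH₂, rfl⟩,
      by ext; simp⟩
  rw [sq]
  exact (Finset.card_le_card hsub).trans (Finset.card_image₂_le _ _ _)

variable [AddCommGroup E] [Module ℝ E]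

variable (E) in
/-- The open half-spaces of a real vector space. The zero functional is allowed, so the empty set
and the whole space count as half-spaces; this gives caps of every height. -/
def openHalfSpaces : Set (Set E) :=
  {H | ∃ (f : Dual ℝ E) (t : ℝ), H = {y | t < f y}}

lemma vcDim_traces_openHalfSpaces_le [FiniteDimensional ℝ E] [DecidableEq ι] (w : ι → E) :
    (traces (openHalfSpaces E) w).vcDim ≤ finrank ℝ E + 1 := by
  refine Finset.sup_le fun s hs => ?_
  rw [Finset.mem_shatterer] at hs
  by_contra! hcard
  have hdep : ¬ AffineIndependent ℝ fun i : s => w i := fun h => by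
    have := h.card_le_finrank_succ
    have := Submodule.finrank_le (vectorSpan ℝ (range fun i : s => w i))
    rw [Fintype.card_coe] at *
    lia
  obtain ⟨I, v, hvI, hvIc⟩ := Convex.radon_partition hdep
  classical
  obtain ⟨T, hT, hsT⟩ := hs (t := s.filter fun i => ∃ h : i ∈ s, (⟨i, h⟩ : s) ∈ I)
    (Finset.filter_subset _ _)
  obtain ⟨_, ⟨f, t, rfl⟩, rfl⟩ := mem_traces.1 hT
  have hmem : ∀ i : s, i ∈ I ↔ t < f (w i) := fun i => by
    simpa using (Finset.ext_iff.1 hsT i).symm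
  have hpos : t < f v := convexHull_min (t := {y | t < f y})
    (by rintro _ ⟨i, hi, rfl⟩; exact (hmem i).1 hi) (convex_halfSpace_gt f.isLinear t) hvI
  have hneg : f v ≤ t := convexHull_min (t := {y | f y ≤ t})
    (by rintro _ ⟨i, hi, rfl⟩; exact not_lt.1 fun h => hi ((hmem i).2 h))
    (convex_halfSpace_le f.isLinear t) hvIc
  exact hpos.not_ge hneg

lemma card_traces_openHalfSpaces_le [FiniteDimensional ℝ E] (w : ι → E) :
    #(traces (openHalfSpaces E) w) ≤
      ∑ k ∈ Finset.Iic (finrank ℝ E + 1), (Fintype.card ι).choose k := by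
  classical
  calc #(traces (openHalfSpaces E) w) ≤ #(traces (openHalfSpaces E) w).shatterer :=
        Finset.card_le_card_shatterer _
    _ ≤ ∑ k ∈ Finset.Iic (traces (openHalfSpaces E) w).vcDim, (Fintype.card ι).choose k :=
        Finset.card_shatterer_le_sum_vcDim
    _ ≤ _ := Finset.sum_le_sum_of_subset
        (Finset.Iic_subset_Iic.2 (vcDim_traces_openHalfSpaces_le w))

lemma sum_choose_le_pow {N D : ℕ} (hD : 1 ≤ D) (hDN : D ≤ N) :
    (∑ k ∈ Finset.Iic D, (N.choose k : ℝ)) ≤ (Real.exp 1 * N / D) ^ D := by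
  have hN0 : (0 : ℝ) < N := by exact_mod_cast hD.trans hDN
  have : (0 : ℝ) < D := by exact_mod_cast hD
  set r : ℝ := D / N with hr
  have hr0 : 0 < r := by positivity
  have hr1 : r ≤ 1 := (div_le_one hN0).2 (by exact_mod_cast hDN)
  have hbinom : (∑ k ∈ Finset.Iic D, (N.choose k : ℝ)) * r ^ D ≤ Real.exp 1 ^ D := by
    calc (∑ k ∈ Finset.Iic D, (N.choose k : ℝ)) * r ^ D
        ≤ ∑ k ∈ Finset.Iic D, (N.choose k : ℝ) * r ^ k := by
          rw [Finset.sum_mul]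
          exact Finset.sum_le_sum fun k hk => mul_le_mul_of_nonneg_left
            (pow_le_pow_of_le_one hr0.le hr1 (Finset.mem_Iic.1 hk)) (Nat.cast_nonneg _)
      _ ≤ ∑ k ∈ Finset.range (N + 1), (N.choose k : ℝ) * r ^ k := by
          refine Finset.sum_le_sum_of_subset_of_nonneg (fun k hk => ?_) fun k _ _ => by positivity
          exact Finset.mem_range_succ_iff.2 ((Finset.mem_Iic.1 hk).trans hDN)
      _ = (r + 1) ^ N := by
          rw [add_pow]
          exact Finset.sum_congr rfl fun k _ => by ring
      _ ≤ Real.exp r ^ N := by gcongr; exact Real.add_one_le_exp r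
      _ = Real.exp 1 ^ D := by
          rw [← Real.exp_nat_mul, ← Real.exp_nat_mul, hr]
          field_simp
  rw [mul_div_assoc, ← inv_div, ← hr, ← div_eq_mul_inv, div_pow]
  exact (le_div_iff₀ (by positivity)).2 hbinom

end HalfSpaces

section RationalSlices

variable {d : ℕ}

lemma isOpen_cap (x : Sph d) (t : ℝ) : IsOpen (cap x t) :=
  isOpen_lt continuous_const (by fun_prop)

lemma cap_subset_cap (x : Sph d) {s t : ℝ} (h : s ≤ t) : cap x t ⊆ cap x s :=
  fun _ hz => h.trans_lt hz

lemma card_traces_le_of_forall_eq_inter_cap {ι : Type*} [Fintype ι] {F : Set (Set (Sph d))}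
    (hF : ∀ B ∈ F, ∃ x y s t, B = cap x s ∩ cap y t) (w : ι → Sph d) :
    #(traces F w) ≤ (∑ k ∈ Finset.Iic (d + 2), (Fintype.card ι).choose k) ^ 2 := by
  have hcap (x : Sph d) (t : ℝ) : ∃ H ∈ openHalfSpaces (EuclideanSpace ℝ (Fin (d + 1))),
      cap x t = Subtype.val ⁻¹' H := ⟨_, ⟨innerₗ _ x.1, t, rfl⟩, rfl⟩
  have hsq := card_traces_le_sq_of_eq_inter_preimage (F := F) (g := Subtype.val)
    (H := openHalfSpaces (EuclideanSpace ℝ (Fin (d + 1)))) (fun B hB => by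
      obtain ⟨x, y, s, t, rfl⟩ := hF B hB
      obtain ⟨H₁, hH₁, hx⟩ := hcap x s
      obtain ⟨H₂, hH₂, hy⟩ := hcap y t
      exact ⟨H₁, hH₁, H₂, hH₂, by rw [hx, hy]⟩) w
  have hhalf := card_traces_openHalfSpaces_le (Subtype.val ∘ w)
  rw [finrank_euclideanSpace_fin] at hhalf
  exact hsq.trans (Nat.pow_le_pow_left hhalf 2)

/-- The slices with rational heights and with centres in the sequence `q`: a countable family
approximating all slices from inside when `q` is dense. -/
def rationalSlices (q : ℕ → Sph d) : Set (Set (Sph d)) :=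
  range fun v : (ℕ × ℕ) × (ℚ × ℚ) => cap (q v.1.1) v.2.1 ∩ cap (q v.1.2) v.2.2

lemma exists_cap_between {q : ℕ → Sph d} (hq : DenseRange q) (x : Sph d) (t : ℝ) {δ : ℝ}
    (hδ : 0 < δ) : ∃ (i : ℕ) (r : ℚ), cap x (t + δ) ⊆ cap (q i) r ∧ cap (q i) r ⊆ cap x t := by
  obtain ⟨i, hi⟩ := hq.exists_dist_lt x (half_pos hδ)
  obtain ⟨r, hr₁, hr₂⟩ := exists_rat_btwn
    (show t + dist x (q i) < t + δ - dist x (q i) by linarith)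
  have hinner (y : Sph d) : |⟪x.1, y.1⟫_ℝ - ⟪(q i).1, y.1⟫_ℝ| ≤ dist x (q i) := by
    rw [← inner_sub_left, Subtype.dist_eq, dist_eq_norm]
    simpa using abs_real_inner_le_norm (x.1 - (q i).1) y.1
  refine ⟨i, r, fun y (hy : t + δ < ⟪x.1, y.1⟫_ℝ) => ?_,
    fun y (hy : (r : ℝ) < ⟪(q i).1, y.1⟫_ℝ) => ?_⟩
  · change (r : ℝ) < ⟪(q i).1, y.1⟫_ℝ
    linarith [(abs_le.1 (hinner y)).2]
  · change t < ⟪x.1, y.1⟫_ℝ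
    linarith [(abs_le.1 (hinner y)).1]

lemma iUnion_cap_add_inter_cap_add (x y : Sph d) (s t : ℝ) :
    ⋃ m : ℕ, cap x (s + 1 / (m + 1)) ∩ cap y (t + 1 / (m + 1)) = cap x s ∩ cap y t := by
  refine Subset.antisymm (iUnion_subset fun m => ?_) 
    fun z ⟨(hx : s < ⟪x.1, z.1⟫_ℝ), (hy : t < ⟪y.1, z.1⟫_ℝ)⟩ => ?_
  · have : 0 < 1 / ((m : ℝ) + 1) := by positivity
    exact inter_subset_inter (cap_subset_cap x (by linarith)) (cap_subset_cap y (by linarith))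
  · obtain ⟨m, hm⟩ := exists_nat_one_div_lt (lt_min (sub_pos.2 hx) (sub_pos.2 hy))
    exact mem_iUnion.2 ⟨m, lt_sub_iff_add_lt'.1 (hm.trans_le (min_le_left _ _)),
      lt_sub_iff_add_lt'.1 (hm.trans_le (min_le_right _ _))⟩

lemma exists_mem_rationalSlices_subset {q : ℕ → Sph d} (hq : DenseRange q) {B : Set (Sph d)}
    (hB : B ∈ slices d) {c : ℝ≥0∞} (hc : c < unif d B) :
    ∃ B' ∈ rationalSlices q, B' ⊆ B ∧ c < unif d B' := by
  obtain ⟨x, y, t, -, s, -, rfl⟩ := hB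
  have hmono : Monotone fun m : ℕ => cap x (s + 1 / (m + 1)) ∩ cap y (t + 1 / (m + 1)) := by
    intro m m' h
    have := one_div_le_one_div_of_le (a := (m : ℝ) + 1) (b := m' + 1) (by positivity) (by simpa)
    exact inter_subset_inter (cap_subset_cap x (by linarith)) (cap_subset_cap y (by linarith))
  rw [← iUnion_cap_add_inter_cap_add, hmono.measure_iUnion, lt_iSup_iff] at hc
  obtain ⟨m, hm⟩ := hc
  obtain ⟨i, a, hxi, hix⟩ := exists_cap_between hq x s (δ := 1 / ((m : ℝ) + 1)) (by positivity)
  obtain ⟨j, b, hyj, hjy⟩ := exists_cap_between hq y t (δ := 1 / ((m : ℝ) + 1)) (by positivity)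
  exact ⟨_, ⟨((i, j), (a, b)), rfl⟩, inter_subset_inter hix hjy,
    hm.trans_le (measure_mono (inter_subset_inter hxi hyj))⟩

lemma disp_le_of_forall_mem_rationalSlices {q : ℕ → Sph d} (hq : DenseRange q) {P : Finset (Sph d)}
    {p : ℝ} (h : ∀ B ∈ rationalSlices q, p ≤ (unif d).real B → ((P : Set (Sph d)) ∩ B).Nonempty) :
    disp P ≤ ENNReal.ofReal p := by
  refine iSup₂_le fun B ⟨hB, hempty⟩ => ?_
  by_contra! hlt
  obtain ⟨B', hB', hsub, hlt'⟩ := exists_mem_rationalSlices_subset hq hB hlt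
  have hp : p ≤ (unif d).real B' := (ENNReal.ofReal_le_iff_le_toReal (measure_ne_top _ _)).1 hlt'.le
  exact ((h B' hB' hp).mono (inter_subset_inter_right _ hsub)).ne_empty hempty

lemma exists_finset_disp_le {n k : ℕ} {p : ℝ} (hn : 1 ≤ n)
    (hk : (((∑ j ∈ Finset.Iic (d + 2), (2 * n).choose j) ^ 2 : ℕ) : ℝ) / 2 ^ k
      + 2 ^ k * (1 - p / 2) ^ n < 1) :
    ∃ P : Finset (Sph d), 1 ≤ #P ∧ #P ≤ n ∧ disp P ≤ ENNReal.ofReal p := by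
  classical
  have : Nonempty (Sph d) := (NormedSpace.sphere_nonempty.2 zero_le_one).to_subtype
  let q := TopologicalSpace.denseSeq (Sph d)
  let F : Set (Set (Sph d)) := {B ∈ rationalSlices q | p ≤ (unif d).real B}
  obtain ⟨X, hX⟩ := exists_epsilonNet_of_card_traces_le (ι := Fin n) (F := F) (μ := unif d) (k := k)
    ((countable_range _).mono fun B hB => hB.1)
    (fun B hB => by
      obtain ⟨v, rfl⟩ := hB.1
      exact ((isOpen_cap _ _).inter (isOpen_cap _ _)).measurableSet)
    (card_traces_le_of_forall_eq_inter_cap fun B hB => by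
      obtain ⟨v, rfl⟩ := hB.1
      exact ⟨_, _, _, _, rfl⟩)
    (fun B hB => hB.2) (by simpa [mul_comm n] using hk)
  have : Nonempty (Fin n) := ⟨⟨0, hn⟩⟩
  refine ⟨Finset.univ.image X, (Finset.univ_nonempty.image X).card_pos,
    Finset.card_image_le.trans (by simp), disp_le_of_forall_mem_rationalSlices
      (TopologicalSpace.denseRange_denseSeq _) fun B hB hp => ?_⟩
  obtain ⟨i, hi⟩ := hX B ⟨hB, hp⟩
  exact ⟨X i, by simp, hi⟩

end RationalSlices

section UpperBound

lemma sum_choose_sq_le_exp {L : ℝ} {d n : ℕ} (hL : 0 ≤ L) (hd : 1 ≤ d)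
    (hn : n ≤ d * (Real.exp L * L)) (hdn : 3 * d ≤ 2 * n) :
    (((∑ k ∈ Finset.Iic (d + 2), (2 * n).choose k) ^ 2 : ℕ) : ℝ) ≤ Real.exp (12 * (d * L)) := by
  have : (0 : ℝ) < d := by exact_mod_cast hd
  have h2L : 2 * L ≤ Real.exp L := by nlinarith [Real.quadratic_le_exp_of_nonneg hL]
  have hbase : Real.exp 1 * (2 * n : ℕ) / (3 * d : ℕ) ≤ Real.exp (2 * L) := by
    push_cast
    rw [div_le_iff₀ (by positivity)]
    calc Real.exp 1 * (2 * n) ≤ 3 * (2 * (d * (Real.exp L * L))) := by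
          gcongr; linarith [Real.exp_one_lt_d9]
      _ = Real.exp L * (2 * L) * (3 * d) := by ring
      _ ≤ Real.exp L * Real.exp L * (3 * d) := by gcongr
      _ = Real.exp (2 * L) * (3 * d) := by rw [← Real.exp_add, two_mul]
  have hsum : ∑ k ∈ Finset.Iic (d + 2), ((2 * n).choose k : ℝ) ≤ Real.exp (6 * (d * L)) :=
    calc ∑ k ∈ Finset.Iic (d + 2), ((2 * n).choose k : ℝ)
        ≤ ∑ k ∈ Finset.Iic (3 * d), ((2 * n).choose k : ℝ) :=
          Finset.sum_le_sum_of_subset_of_nonneg (Finset.Iic_subset_Iic.2 (by lia))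
            fun k _ _ => by positivity
      _ ≤ (Real.exp 1 * (2 * n : ℕ) / (3 * d : ℕ)) ^ (3 * d) := sum_choose_le_pow (by lia) hdn
      _ ≤ Real.exp (2 * L) ^ (3 * d) := by gcongr
      _ = Real.exp (6 * (d * L)) := by
          rw [← Real.exp_nat_mul]; push_cast; ring_nf
  push_cast
  calc _ ≤ Real.exp (6 * (d * L)) ^ 2 := by gcongr
    _ = Real.exp (12 * (d * L)) := by rw [← Real.exp_nat_mul]; push_cast; ring_nf

lemma two_pow_eq_exp (k : ℕ) : (2 : ℝ) ^ k = Real.exp (k * Real.log 2) := by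
  rw [Real.exp_nat_mul, Real.exp_log two_pos]

lemma exp_le_two_pow_ceil (A : ℝ) : Real.exp (13 * A) ≤ 2 ^ ⌈20 * A⌉₊ := by
  rw [two_pow_eq_exp, Real.exp_le_exp]
  nlinarith [Nat.le_ceil (20 * A), Real.log_two_gt_d9, Nat.cast_nonneg (α := ℝ) ⌈20 * A⌉₊]

lemma two_pow_ceil_le_exp {A : ℝ} (hA : 1 ≤ A) : 2 ^ ⌈20 * A⌉₊ ≤ Real.exp (15 * A) := by
  rw [two_pow_eq_exp, Real.exp_le_exp]
  nlinarith [Nat.ceil_lt_add_one (a := 20 * A) (by linarith), Real.log_two_lt_d9,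
    Real.log_pos one_lt_two]

lemma div_two_pow_ceil_add_mul_pow_lt_one {G A ε : ℝ} {n : ℕ} (hA : 1 ≤ A)
    (hG : G ≤ Real.exp (12 * A)) (hε : ε ≤ 4) (hεn : 92 * A ≤ ε * n) :
    G / 2 ^ ⌈20 * A⌉₊ + 2 ^ ⌈20 * A⌉₊ * (1 - ε / 2 / 2) ^ n < 1 := by
  have hhalf : Real.exp (-A) < 1 / 2 :=
    (Real.exp_le_exp.2 (neg_le_neg hA)).trans_lt Real.exp_neg_one_lt_half
  have hfirst : G / 2 ^ ⌈20 * A⌉₊ ≤ Real.exp (-A) := by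
    rw [div_le_iff₀ (by positivity)]
    calc G ≤ Real.exp (-A) * Real.exp (13 * A) := by rw [← Real.exp_add]; convert hG using 2; ring
      _ ≤ Real.exp (-A) * 2 ^ ⌈20 * A⌉₊ := by gcongr; exact exp_le_two_pow_ceil A
  have hpow : (1 - ε / 2 / 2) ^ n ≤ Real.exp (-(23 * A)) :=
    calc (1 - ε / 2 / 2) ^ n ≤ Real.exp (-(ε / 4)) ^ n :=
          pow_le_pow_left₀ (by linarith) (by linarith [Real.add_one_le_exp (-(ε / 4))]) n
      _ = Real.exp (-(ε * n / 4)) := by rw [← Real.exp_nat_mul]; ring_nf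
      _ ≤ Real.exp (-(23 * A)) := Real.exp_le_exp.2 (by linarith)
  have hsecond : 2 ^ ⌈20 * A⌉₊ * (1 - ε / 2 / 2) ^ n ≤ Real.exp (-A) :=
    calc 2 ^ ⌈20 * A⌉₊ * (1 - ε / 2 / 2) ^ n ≤ 2 ^ ⌈20 * A⌉₊ * Real.exp (-(23 * A)) := by gcongr
      _ ≤ Real.exp (15 * A) * Real.exp (-(23 * A)) := by gcongr; exact two_pow_ceil_le_exp hA
      _ = Real.exp (-(8 * A)) := by rw [← Real.exp_add]; ring_nf
      _ ≤ Real.exp (-A) := Real.exp_le_exp.2 (by linarith)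
  linarith

lemma exists_mem_admissible_le {ε : ℝ} (hε : 0 < ε) (hε' : ε ≤ 1) {d : ℕ} (hd : 1 ≤ d) :
    ∃ m ∈ admissible ε d, (m : ℝ) ≤ 96 * ((d : ℝ) / ε) * Real.log (96 / ε) := by
  set L := Real.log (96 / ε)
  have hexp : Real.exp L = 96 / ε := Real.exp_log (by positivity)
  have hL : 1 ≤ L := by
    rw [Real.le_log_iff_exp_le (by positivity), le_div_iff₀ hε]
    nlinarith [Real.exp_one_lt_d9, Real.exp_pos 1]
  have hd' : (1 : ℝ) ≤ d := by exact_mod_cast hd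
  have hA : (d : ℝ) ≤ d * L := le_mul_of_one_le_right (by positivity) hL
  set n := ⌊96 * ((d : ℝ) / ε) * L⌋₊
  have hn_le : (n : ℝ) ≤ 96 * (d / ε) * L := Nat.floor_le (by positivity)
  have hεn : 95 * (d * L) ≤ ε * n := by
    have hfloor : ε * (96 * (d / ε) * L) < ε * (n + 1) := by gcongr; exact Nat.lt_floor_add_one _
    have : ε * (96 * (d / ε) * L) = 96 * (d * L) := by field_simp
    linarith
  have hdn : 95 * d ≤ n := by
    have : ε * n ≤ n := mul_le_of_le_one_left n.cast_nonneg hε'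
    have : (95 * d : ℝ) ≤ n := by linarith
    exact_mod_cast this
  have hG := sum_choose_sq_le_exp (L := L) (n := n) (by linarith) hd
    (hn_le.trans_eq (by rw [hexp]; ring)) (by lia)
  obtain ⟨P, hP, hPn, hdisp⟩ := exists_finset_disp_le (d := d) (p := ε / 2) (n := n) (by lia)
    (div_two_pow_ceil_add_mul_pow_lt_one (by linarith) hG (by linarith) (by linarith))
  refine ⟨#P, ⟨hP, ?_⟩, le_trans (by exact_mod_cast hPn) hn_le⟩
  calc minDisp #P d ≤ disp P := iInf₂_le P (by simp)
    _ ≤ ENNReal.ofReal (ε / 2) := hdisp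
    _ < ENNReal.ofReal ε := (ENNReal.ofReal_lt_ofReal_iff hε).2 (by linarith)

end UpperBound

section InverseDispersion

variable {ε : ℝ} {d : ℕ}

lemma isLeast_invMinDisp (hε : 0 < ε) (hε' : ε ≤ 1) (hd : 1 ≤ d) :
    IsLeast (admissible ε d) (invMinDisp ε d) :=
  let ⟨m, hm, _⟩ := exists_mem_admissible_le hε hε' hd
  ⟨Nat.sInf_mem ⟨m, hm⟩, fun _ => Nat.sInf_le⟩

lemma invMinDisp_le (hε : 0 < ε) (hε' : ε ≤ 1) (hd : 1 ≤ d) :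
    (invMinDisp ε d : ℝ) ≤ 96 * ((d : ℝ) / ε) * Real.log (96 / ε) :=
  let ⟨_, hm, hle⟩ := exists_mem_admissible_le hε hε' hd
  le_trans (by exact_mod_cast Nat.sInf_le hm) hle

lemma max_le_invMinDisp (hε : 0 < ε) (hε' : ε ≤ 1 / 4) (hd : 1 ≤ d) :
    max (1 / ε + (d : ℝ) - 2) (1 / (2 * ε) + 2 * (d : ℝ) - 2) ≤ (invMinDisp ε d : ℝ) :=
  max_le_of_mem_admissible hε hε' hd (isLeast_invMinDisp hε (by linarith) hd).1

lemma natCast_le_invMinDisp (hε : 0 < ε) (hε' : ε ≤ 1 / 4) (hd : 1 ≤ d) :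
    (d : ℝ) ≤ invMinDisp ε d := by
  have hmax := (le_max_left _ _).trans (max_le_invMinDisp hε hε' hd)
  have : 4 ≤ 1 / ε := (le_one_div (by norm_num) hε).2 hε'
  linarith

lemma half_mul_one_div_le_invMinDisp (hε : 0 < ε) (hε' : ε ≤ 1 / 4) (hd : 1 ≤ d) :
    1 / 2 * (1 / ε) ≤ invMinDisp ε d := by
  have hmax := (le_max_left _ _).trans (max_le_invMinDisp hε hε' hd)
  have : 4 ≤ 1 / ε := (le_one_div (by norm_num) hε).2 hε'
  have : (1 : ℝ) ≤ d := by exact_mod_cast hd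
  linarith

lemma invMinDisp_le_mul_log (hε : 0 < ε) (hε' : ε ≤ 1 / 4) (hd : 1 ≤ d) :
    (invMinDisp ε d : ℝ) ≤ 480 * d * (1 / ε * Real.log (1 / ε)) := by
  have h4 : 4 ≤ 1 / ε := (le_one_div (by norm_num) hε).2 hε'
  have hlog : Real.log (96 / ε) ≤ 5 * Real.log (1 / ε) :=
    calc Real.log (96 / ε) ≤ Real.log ((1 / ε) ^ 5) := by
          refine Real.log_le_log (by positivity) ?_
          calc 96 / ε ≤ 4 ^ 4 * (1 / ε) := by rw [div_eq_mul_one_div]; gcongr; norm_num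
            _ ≤ (1 / ε) ^ 4 * (1 / ε) := by gcongr
            _ = (1 / ε) ^ 5 := (pow_succ _ 4).symm
      _ = 5 * Real.log (1 / ε) := by rw [Real.log_pow]; norm_num
  calc (invMinDisp ε d : ℝ) ≤ 96 * ((d : ℝ) / ε) * Real.log (96 / ε) :=
        invMinDisp_le hε (by linarith) hd
    _ ≤ 96 * ((d : ℝ) / ε) * (5 * Real.log (1 / ε)) := by gcongr
    _ = 480 * d * (1 / ε * Real.log (1 / ε)) := by ring

end InverseDispersion

end SphericalDispersion

theorem mainTheorem5_general :
    (∀ ε : ℝ, 0 < ε → ε ≤ 1 / 4 → ∀ d : ℕ, 1 ≤ d →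
      IsLeast (SphericalDispersion.admissible ε d) (SphericalDispersion.invMinDisp ε d) ∧
      max (1 / ε + (d : ℝ) - 2) (1 / (2 * ε) + 2 * (d : ℝ) - 2)
        ≤ (SphericalDispersion.invMinDisp ε d : ℝ) ∧
      (SphericalDispersion.invMinDisp ε d : ℝ) ≤ 96 * ((d : ℝ) / ε) * Real.log (96 / ε)) ∧
    (∀ ε : ℝ, 0 < ε → ε ≤ 1 / 4 →
      ∃ c C : ℝ, 0 < c ∧ 0 < C ∧ ∀ d : ℕ, 1 ≤ d →
        c * (d : ℝ) ≤ (SphericalDispersion.invMinDisp ε d : ℝ) ∧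
        (SphericalDispersion.invMinDisp ε d : ℝ) ≤ C * (d : ℝ)) ∧
    (∀ d : ℕ, 1 ≤ d →
      ∃ c C : ℝ, 0 < c ∧ 0 < C ∧ ∀ ε : ℝ, 0 < ε → ε ≤ 1 / 4 →
        c * (1 / ε) ≤ (SphericalDispersion.invMinDisp ε d : ℝ) ∧
        (SphericalDispersion.invMinDisp ε d : ℝ) ≤ C * ((1 / ε) * Real.log (1 / ε))) := by
  open SphericalDispersion in
  refine ⟨fun ε hε hε' d hd => ⟨isLeast_invMinDisp hε (by linarith) hd,
    max_le_invMinDisp hε hε' hd, invMinDisp_le hε (by linarith) hd⟩, fun ε hε hε' => ?_,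
    fun d hd => ⟨1 / 2, 480 * d, by positivity, by positivity, fun ε hε hε' =>
      ⟨half_mul_one_div_le_invMinDisp hε hε' hd, invMinDisp_le_mul_log hε hε' hd⟩⟩⟩
  have hlog : 0 < Real.log (96 / ε) := Real.log_pos ((one_lt_div hε).2 (by linarith))
  refine ⟨1, 96 / ε * Real.log (96 / ε), one_pos, by positivity, fun d hd => ⟨?_, ?_⟩⟩
  · rw [one_mul]
    exact natCast_le_invMinDisp hε hε' hd
  · exact (invMinDisp_le hε (by linarith) hd).trans_eq (by ring)

theorem mainTheorem5 :
    (∀ ε : ℝ, 0 < ε → ε < 1 / (9 * Real.exp 1) → ∀ d : ℕ, 1 ≤ d →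
      IsLeast (SphericalDispersion.admissible ε d) (SphericalDispersion.invMinDisp ε d) ∧
      max (1 / ε + (d : ℝ) - 2) (1 / (2 * ε) + 2 * (d : ℝ) - 2)
        ≤ (SphericalDispersion.invMinDisp ε d : ℝ) ∧
      (SphericalDispersion.invMinDisp ε d : ℝ) ≤ 96 * ((d : ℝ) / ε) * Real.log (96 / ε)) ∧
    (∀ ε : ℝ, 0 < ε → ε < 1 / (9 * Real.exp 1) →
      ∃ c C : ℝ, 0 < c ∧ 0 < C ∧ ∀ d : ℕ, 1 ≤ d →
        c * (d : ℝ) ≤ (SphericalDispersion.invMinDisp ε d : ℝ) ∧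
        (SphericalDispersion.invMinDisp ε d : ℝ) ≤ C * (d : ℝ)) ∧
    (∀ d : ℕ, 1 ≤ d →
      ∃ c C : ℝ, 0 < c ∧ 0 < C ∧ ∀ ε : ℝ, 0 < ε → ε < 1 / (9 * Real.exp 1) →
        c * (1 / ε) ≤ (SphericalDispersion.invMinDisp ε d : ℝ) ∧
        (SphericalDispersion.invMinDisp ε d : ℝ) ≤ C * ((1 / ε) * Real.log (1 / ε))) := by
  obtain ⟨hbounds, hdim, hε⟩ := mainTheorem5_general
  have hle {ε : ℝ} (h : ε < 1 / (9 * Real.exp 1)) : ε ≤ 1 / 4 :=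
    h.le.trans (one_div_le_one_div_of_le (by norm_num) (by linarith [Real.add_one_le_exp 1]))
  refine ⟨fun ε h0 h => hbounds ε h0 (hle h), fun ε h0 h => hdim ε h0 (hle h), fun d hd => ?_⟩
  obtain ⟨c, C, hc, hC, hcC⟩ := hε d hd
  exact ⟨c, C, hc, hC, fun ε h0 h => hcC ε h0 (hle h)⟩
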